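/- Let $R$ be a left and right Noetherian (associative, unital) ring. For a left $R$-module $M$, let $E^0(M)$ denote the injective envelope of $M$, and let $\operatorname{fd}_R M\in\{0,1,2,\dots\}\cup\{\infty\}$ denote the flat dimension of $M$, i.e. the least $n\ge 0$ for which there is an exact sequence $0\to F_n\to\cdots\to F_1\to F_0\to M\to 0$ with all $F_i$ flat left $R$-modules ($\infty$ if there is no such $n$). A left $R$-module $G$ is called Gorenstein flat if there is an exact sequence $$\cdots\to F_1\to F_0\to F^0\to F^1\to\cdots$$ of flat left $R$-modules with $G\cong\operatorname{Im}(F_0\to F^0)$ that remains exact after applying $I\otimes_R-$ for every injective right $R$-module $I$. Then $$\operatorname{fd}_R E^0({}_RR)=\sup\{\operatorname{fd}_R E^0(F)\mid F \text{ a flat left } R\text{-module}\}=\sup\{\operatorname{fd}_R E^0(G)\mid G \text{ a Gorenstein flat left } R\text{-module}\},$$ the values being compared in $\{0,1,2,\dots\}\cup\{\infty\}$, so that one of them is infinite if and only if all are. -/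

import Mathlib

open scoped TensorProduct

universe u

namespace InjEnvFlat

/-! ### The tensor product of a right module and a left module

Left modules over `R` are `Module R M`, right modules over `R` are `Module Rᵐᵒᵖ N`, the right
action `n * r` being written `MulOpposite.op r • n`. -/

section Tensor

variable (R : Type u) [Ring R]

/-- The subgroup of `N ⊗[ℤ] M` generated by the elements `n r ⊗ m - n ⊗ r m`. -/
def balancedRel (N M : Type u) [AddCommGroup N] [Module Rᵐᵒᵖ N] [AddCommGroup M] [Module R M] :
    Submodule ℤ (N ⊗[ℤ] M) :=
  Submodule.span ℤ {x | ∃ (r : R) (n : N) (m : M),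
    x = (MulOpposite.op r • n) ⊗ₜ[ℤ] m - n ⊗ₜ[ℤ] (r • m)}

/-- The abelian group `N ⊗_R M` for a right `R`-module `N` and a left `R`-module `M`. -/
abbrev Tens (N M : Type u) [AddCommGroup N] [Module Rᵐᵒᵖ N] [AddCommGroup M] [Module R M] :
    Type u :=
  (N ⊗[ℤ] M) ⧸ balancedRel R N M

variable {R}
variable {N N' M M' : Type u} [AddCommGroup N] [Module Rᵐᵒᵖ N] [AddCommGroup N'] [Module Rᵐᵒᵖ N']
  [AddCommGroup M] [Module R M] [AddCommGroup M'] [Module R M']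

theorem balancedRel_le_comap (f : N →ₗ[Rᵐᵒᵖ] N') (g : M →ₗ[R] M') :
    balancedRel R N M ≤ (balancedRel R N' M').comap
      (TensorProduct.map f.toAddMonoidHom.toIntLinearMap g.toAddMonoidHom.toIntLinearMap) := by
  refine Submodule.span_le.2 ?_
  rintro _ ⟨r, n, m, rfl⟩
  refine Submodule.subset_span ⟨r, f n, g m, ?_⟩
  simp

/-- The homomorphism `f ⊗ g : N ⊗_R M → N' ⊗_R M'`. -/
def tensMap (f : N →ₗ[Rᵐᵒᵖ] N') (g : M →ₗ[R] M') : Tens R N M →ₗ[ℤ] Tens R N' M' :=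
  Submodule.mapQ _ _
    (TensorProduct.map f.toAddMonoidHom.toIntLinearMap g.toAddMonoidHom.toIntLinearMap)
    (balancedRel_le_comap f g)

end Tensor

/-! ### Flat modules, flat dimension, Gorenstein flat modules -/

section Flat

variable (R : Type u) [Ring R]

/-- A left `R`-module `M` is flat if `- ⊗_R M` preserves monomorphisms of right `R`-modules. -/
def IsFlat (M : Type u) [AddCommGroup M] [Module R M] : Prop :=
  ∀ ⦃N N' : Type u⦄ [AddCommGroup N] [AddCommGroup N'] [Module Rᵐᵒᵖ N] [Module Rᵐᵒᵖ N']
    (f : N →ₗ[Rᵐᵒᵖ] N'), Function.Injective f →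
      Function.Injective (tensMap f (LinearMap.id : M →ₗ[R] M))

/-- `M` has a flat resolution `0 → F n → ⋯ → F 1 → F 0 → M → 0` of length at most `n`. -/
def HasFlatDimLE (M : Type u) [AddCommGroup M] [Module R M] (n : ℕ) : Prop :=
  ∃ (F : ℕ → ModuleCat.{u} R) (d : ∀ k, F (k + 1) →ₗ[R] F k) (ε : F 0 →ₗ[R] M),
    (∀ k, IsFlat R (F k)) ∧ (∀ k, n < k → Subsingleton (F k)) ∧
    Function.Surjective ε ∧ Function.Exact (d 0) ε ∧
    ∀ k, Function.Exact (d (k + 1)) (d k)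

/-- The flat dimension of a left module: the least length of a flat resolution, and `⊤` if there is
no finite one. -/
noncomputable def flatDim (M : Type u) [AddCommGroup M] [Module R M] : ℕ∞ :=
  ⨅ (n : ℕ) (_ : HasFlatDimLE R M n), (n : ℕ∞)

/-- A left module `M` is Gorenstein flat if it is isomorphic to the image of one of the
differentials of an exact sequence `⋯ → X (-1) → X 0 → X 1 → ⋯` of flat left modules which stays
exact under `I ⊗_R -` for every injective right module `I`. Here `X 0 → X 1` plays the role of the
middle arrow `F_0 → F^0`. -/
def IsGorensteinFlat (M : Type u) [AddCommGroup M] [Module R M] : Prop :=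
  ∃ (X : ℤ → ModuleCat.{u} R) (d : ∀ k, X k →ₗ[R] X (k + 1)),
    (∀ k, IsFlat R (X k)) ∧
    (∀ k, Function.Exact (d k) (d (k + 1))) ∧
    (∀ (I : Type u) [AddCommGroup I] [Module Rᵐᵒᵖ I], Module.Injective Rᵐᵒᵖ I →
      ∀ k, Function.Exact (tensMap (LinearMap.id : I →ₗ[Rᵐᵒᵖ] I) (d k))
        (tensMap (LinearMap.id : I →ₗ[Rᵐᵒᵖ] I) (d (k + 1)))) ∧
    Nonempty (M ≃ₗ[R] LinearMap.range (d 0))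

end Flat

/-! ### Injective envelopes -/

section Envelope

variable (R : Type u) [Ring R]

/-- `i : M → E` is an injective envelope: `E` is injective, and `i` is a monomorphism whose image
is an essential submodule, i.e. meets every nonzero submodule of `E` nontrivially. -/
structure IsInjectiveEnvelope {M E : Type u} [AddCommGroup M] [Module R M]
    [AddCommGroup E] [Module R E] (i : M →ₗ[R] E) : Prop where
  injective_module : Module.Injective R E
  injective_map : Function.Injective i
  essential : ∀ N : Submodule R E, LinearMap.range i ⊓ N = ⊥ → N = ⊥

/-- Every submodule of an injective module has an injective envelope inside that module. -/
theorem exists_envelope_in {J : Type u} [AddCommGroup J] [Module R J] (hJ : Module.Injective R J)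
    (A : Submodule R J) :
    ∃ (E : Submodule R J), A ≤ E ∧ (∀ x ∈ E, x ≠ 0 → ∃ r : R, r • x ∈ A ∧ r • x ≠ 0) ∧
      Module.Injective R E := by
  obtain ⟨E, hAE, hE⟩ := zorn_le_nonempty₀
    {E : Submodule R J | A ≤ E ∧ ∀ x ∈ E, x ≠ 0 → ∃ r : R, r • x ∈ A ∧ r • x ≠ 0}
    (by
      intro c hc hch y hy
      refine ⟨sSup c, ⟨(hc hy).1.trans (le_sSup hy), ?_⟩, fun z hz => le_sSup hz⟩
      intro x hx hx0
      obtain ⟨z, hz, hxz⟩ := (Submodule.mem_sSup_of_directed ⟨y, hy⟩ hch.directedOn).1 hx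
      exact (hc hz).2 x hxz hx0)
    A ⟨le_rfl, fun x hx hx0 => ⟨1, by simpa using hx, by simpa using hx0⟩⟩
  obtain ⟨C, -, hC⟩ := zorn_le_nonempty₀
    {C : Submodule R J | ∀ x ∈ C, x ∈ E → x = 0}
    (by
      intro c hc hch y hy
      refine ⟨sSup c, ?_, fun z hz => le_sSup hz⟩
      intro x hx hxE
      obtain ⟨z, hz, hxz⟩ := (Submodule.mem_sSup_of_directed ⟨y, hy⟩ hch.directedOn).1 hx
      exact hc hz x hxz hxE)
    ⊥ (by intro x hx _; simpa using hx)
  have hφ : Function.Injective (C.mkQ ∘ₗ E.subtype) := by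
    rw [← LinearMap.ker_eq_bot, LinearMap.ker_eq_bot']
    intro e he
    have : (e : J) ∈ C := by simpa using he
    exact Subtype.ext (hC.prop _ this e.2)
  obtain ⟨h, hh⟩ := hJ.out (C.mkQ ∘ₗ E.subtype) hφ E.subtype
  have hfix : ∀ e ∈ E, h (C.mkQ e) = e := fun e he => hh ⟨e, he⟩
  have hrange : ∀ j, h (C.mkQ j) ∈ E := by
    have hmem : LinearMap.range (h ∘ₗ C.mkQ) ∈
        {E : Submodule R J | A ≤ E ∧ ∀ x ∈ E, x ≠ 0 → ∃ r : R, r • x ∈ A ∧ r • x ≠ 0} := by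
      refine ⟨fun a ha => ⟨a, hfix a (hAE ha)⟩, ?_⟩
      rintro _ ⟨j, rfl⟩ hj0
      have hjC : j ∉ C := by
        intro hj
        apply hj0
        have : C.mkQ j = 0 := by simpa using hj
        simp only [LinearMap.comp_apply, this, map_zero]
      have hlt : ¬ (C ⊔ Submodule.span R {j} : Submodule R J) ≤ C := fun hle =>
        hjC (hle (Submodule.mem_sup_right (Submodule.mem_span_singleton_self j)))
      have hnot : ¬ ∀ x ∈ (C ⊔ Submodule.span R {j} : Submodule R J), x ∈ E → x = 0 :=
        fun hall => hlt (hC.le_of_ge hall le_sup_left)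
      push Not at hnot
      obtain ⟨x, hx, hxE, hx0⟩ := hnot
      obtain ⟨y, hy, z, hz, rfl⟩ := Submodule.mem_sup.1 hx
      obtain ⟨r, rfl⟩ := Submodule.mem_span_singleton.1 hz
      have hyz : C.mkQ y = 0 := by simpa using hy
      have key : r • h (C.mkQ j) = y + r • j := by
        have := hfix _ hxE
        rwa [map_add, hyz, zero_add, map_smul, map_smul] at this
      obtain ⟨s, hs, hs0⟩ := hE.prop.2 _ hxE hx0
      refine ⟨s * r, ?_, ?_⟩
      · rw [LinearMap.comp_apply, mul_smul, key]; exact hs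
      · rw [LinearMap.comp_apply, mul_smul, key]; exact hs0
    have hle := hE.le_of_ge hmem (fun e he => ⟨e, hfix e he⟩)
    exact fun j => hle ⟨j, rfl⟩
  refine ⟨E, hAE, hE.prop.2, ⟨?_⟩⟩
  intro X Y _ _ _ _ f hf g
  obtain ⟨k, hk⟩ := hJ.out f hf (E.subtype ∘ₗ g)
  refine ⟨(h ∘ₗ C.mkQ ∘ₗ k).codRestrict E (fun y => hrange (k y)), fun x => Subtype.ext ?_⟩
  change h (C.mkQ (k (f x))) = g x
  rw [hk]
  exact hfix _ (g x).2

theorem exists_injectiveEnvelope (M : Type u) [AddCommGroup M] [Module R M] :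
    ∃ (E : ModuleCat.{u} R) (i : M →ₗ[R] E), IsInjectiveEnvelope R i := by
  let J : ModuleCat.{u} R := CategoryTheory.Injective.under (ModuleCat.of R M)
  let ι : M →ₗ[R] J := (CategoryTheory.Injective.ι (ModuleCat.of R M)).hom
  have hι : Function.Injective ι := (ModuleCat.mono_iff_injective _).1 inferInstance
  have hJ : Module.Injective R J :=
    (Module.injective_iff_injective_object R J).2
      (inferInstanceAs (CategoryTheory.Injective (CategoryTheory.Injective.under _)))
  obtain ⟨E, hAE, hess, hE⟩ := exists_envelope_in R hJ (LinearMap.range ι)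
  refine ⟨ModuleCat.of R E, ι.codRestrict E (fun m => hAE ⟨m, rfl⟩), hE, ?_, ?_⟩
  · intro a b hab
    exact hι (congrArg Subtype.val hab)
  · intro N hN
    rw [Submodule.eq_bot_iff]
    intro x hx
    by_contra hx0
    obtain ⟨r, ⟨m, hm⟩, hr0⟩ := hess x.1 x.2 (fun h => hx0 (Subtype.ext h))
    have : r • x ∈ LinearMap.range (ι.codRestrict E (fun m => hAE ⟨m, rfl⟩)) ⊓ N :=
      ⟨⟨m, Subtype.ext hm⟩, N.smul_mem r hx⟩
    rw [hN] at this
    exact hr0 (congrArg Subtype.val ((Submodule.mem_bot R).1 this))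

/-- The injective envelope `E⁰(M)` of `M` (unique up to isomorphism). -/
noncomputable def injEnvelope (M : Type u) [AddCommGroup M] [Module R M] : ModuleCat.{u} R :=
  (exists_injectiveEnvelope R M).choose

/-- The inclusion `M → E⁰(M)`. -/
noncomputable def injEnvelopeMap (M : Type u) [AddCommGroup M] [Module R M] :
    M →ₗ[R] injEnvelope R M :=
  (exists_injectiveEnvelope R M).choose_spec.choose

theorem injEnvelopeMap_spec (M : Type u) [AddCommGroup M] [Module R M] :
    IsInjectiveEnvelope R (injEnvelopeMap R M) :=
  (exists_injectiveEnvelope R M).choose_spec.choose_spec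

end Envelope

end InjEnvFlat

/-! Everything reduces to one inequality: fd E⁰(M) ≤ fd E⁰(R) for every submodule M of a flat
module. A flat module is such an M, a Gorenstein flat module embeds in the next term of its complex,
and R itself is flat and hence Gorenstein flat.

For x in a flat module, ann(x) is finitely generated, and the equational criterion of flatness turns
the relations s x = 0 into x = ∑ lₖ yₖ with s lₖ = 0. So x and the tuple (lₖ) have the same
annihilator, and R x embeds in a free module (`IsFlat.exists_smul_eq_zero_iff`). An essential direct
sum of cyclic submodules of M then embeds in a direct sum of copies of E⁰(R), which is injective
because R is left Noetherian. The embedding extends to E⁰(M), stays injective by essentiality, and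
splits (`exists_envelope_embedding`).

It remains that flat dimension does not grow under direct sums and retracts
(`SyzygyFlatDimLE.finsupp`, `SyzygyFlatDimLE.of_retract`). This is proved without Tor, by a Schanuel
argument on first syzygies. -/

namespace InjEnvFlat

/-! ### Tensor products over a noncommutative ring: right exactness and purity. -/

section TensorLemmas

variable {R : Type u} [Ring R]
variable {N N' N'' M M' M'' : Type u} [AddCommGroup N] [Module Rᵐᵒᵖ N]
  [AddCommGroup N'] [Module Rᵐᵒᵖ N'] [AddCommGroup N''] [Module Rᵐᵒᵖ N'']
  [AddCommGroup M] [Module R M] [AddCommGroup M'] [Module R M'] [AddCommGroup M''] [Module R M'']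

variable (R) in
/-- The class of `n ⊗ m` in `N ⊗_R M`. -/
def tmul (n : N) (m : M) : Tens R N M := Submodule.mkQ (balancedRel R N M) (n ⊗ₜ[ℤ] m)

theorem tmul_add (n : N) (m m' : M) : tmul R n (m + m') = tmul R n m + tmul R n m' := by
  simp only [tmul, TensorProduct.tmul_add, map_add]

theorem tmul_zero (n : N) : tmul R n (0 : M) = 0 := by
  simp only [tmul, TensorProduct.tmul_zero, map_zero]

theorem add_tmul (n n' : N) (m : M) : tmul R (n + n') m = tmul R n m + tmul R n' m := by
  simp only [tmul, TensorProduct.add_tmul, map_add]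

theorem zero_tmul (m : M) : tmul R (0 : N) m = 0 := by
  simp only [tmul, TensorProduct.zero_tmul, map_zero]

theorem op_smul_tmul (r : R) (n : N) (m : M) :
    tmul R (MulOpposite.op r • n) m = tmul R n (r • m) := by
  rw [← sub_eq_zero, tmul, tmul, ← map_sub, Submodule.mkQ_apply, Submodule.Quotient.mk_eq_zero]
  exact Submodule.subset_span ⟨r, n, m, rfl⟩

@[simp]
theorem tensMap_tmul (f : N →ₗ[Rᵐᵒᵖ] N') (g : M →ₗ[R] M') (n : N) (m : M) :
    tensMap f g (tmul R n m) = tmul R (f n) (g m) := rfl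

theorem tens_induction {p : Tens R N M → Prop} (h0 : p 0) (ht : ∀ n m, p (tmul R n m))
    (ha : ∀ x y, p x → p y → p (x + y)) (t : Tens R N M) : p t := by
  obtain ⟨t, rfl⟩ := Submodule.mkQ_surjective _ t
  induction t with
  | zero => simpa using h0
  | tmul n m => exact ht n m
  | add x y hx hy => rw [map_add]; exact ha _ _ hx hy

theorem tens_hom_ext {A : Type*} [AddCommGroup A] {φ ψ : Tens R N M →ₗ[ℤ] A}
    (h : ∀ n m, φ (tmul R n m) = ψ (tmul R n m)) : φ = ψ := by
  refine LinearMap.ext fun t => ?_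
  induction t using tens_induction with
  | h0 => simp
  | ht n m => exact h n m
  | ha x y hx hy => rw [map_add, map_add, hx, hy]

theorem tensMap_id : tensMap (LinearMap.id : N →ₗ[Rᵐᵒᵖ] N) (LinearMap.id : M →ₗ[R] M)
    = LinearMap.id := tens_hom_ext fun n m => by simp

theorem tensMap_comp (f' : N' →ₗ[Rᵐᵒᵖ] N'') (g' : M' →ₗ[R] M'')
    (f : N →ₗ[Rᵐᵒᵖ] N') (g : M →ₗ[R] M') :
    tensMap f' g' ∘ₗ tensMap f g = tensMap (f' ∘ₗ f) (g' ∘ₗ g) :=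
  tens_hom_ext fun n m => by simp

theorem tensMap_tensMap (f' : N' →ₗ[Rᵐᵒᵖ] N'') (g' : M' →ₗ[R] M'')
    (f : N →ₗ[Rᵐᵒᵖ] N') (g : M →ₗ[R] M') (t : Tens R N M) :
    tensMap f' g' (tensMap f g t) = tensMap (f' ∘ₗ f) (g' ∘ₗ g) t :=
  DFunLike.congr_fun (tensMap_comp f' g' f g) t

theorem tensMap_add_right (f : N →ₗ[Rᵐᵒᵖ] N') (g h : M →ₗ[R] M') :
    tensMap f (g + h) = tensMap f g + tensMap f h :=
  tens_hom_ext fun n m => by simp [tmul_add]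

theorem tensMap_zero_right (f : N →ₗ[Rᵐᵒᵖ] N') :
    tensMap f (0 : M →ₗ[R] M') = 0 :=
  tens_hom_ext fun n m => by simp [tmul_zero]

theorem tensMap_zero_left (g : M →ₗ[R] M') :
    tensMap (0 : N →ₗ[Rᵐᵒᵖ] N') g = 0 :=
  tens_hom_ext fun n m => by simp [zero_tmul]

/-- The homomorphism out of `N ⊗_R M` given by a balanced biadditive map. -/
def tensLift {A : Type*} [AddCommGroup A] (φ : N →+ M →+ A)
    (hφ : ∀ (r : R) n m, φ (MulOpposite.op r • n) m = φ n (r • m)) : Tens R N M →ₗ[ℤ] A :=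
  Submodule.liftQ _ (TensorProduct.liftAddHom φ (fun z n m => by simp)).toIntLinearMap (by
    refine Submodule.span_le.2 ?_
    rintro _ ⟨r, n, m, rfl⟩
    simp [hφ])

@[simp]
theorem tensLift_tmul {A : Type*} [AddCommGroup A] (φ : N →+ M →+ A)
    (hφ : ∀ (r : R) n m, φ (MulOpposite.op r • n) m = φ n (r • m)) (n : N) (m : M) :
    tensLift φ hφ (tmul R n m) = φ n m := rfl

theorem tensMap_surjective {f : N →ₗ[Rᵐᵒᵖ] N'} {g : M →ₗ[R] M'} (hf : Function.Surjective f)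
    (hg : Function.Surjective g) : Function.Surjective (tensMap f g) := by
  intro t
  induction t using tens_induction with
  | h0 => exact ⟨0, map_zero _⟩
  | ht n m =>
    obtain ⟨n, rfl⟩ := hf n
    obtain ⟨m, rfl⟩ := hg m
    exact ⟨tmul R n m, by simp⟩
  | ha x y hx hy =>
    obtain ⟨x, rfl⟩ := hx
    obtain ⟨y, rfl⟩ := hy
    exact ⟨x + y, map_add _ _ _⟩

/-- A relation in `N' ⊗_R M'` lifts along surjections, so an element of the kernel of `f ⊗ g` has a
representative in the kernel of the map of tensor products over `ℤ`. -/
theorem exists_rep_of_tensMap_eq_zero {f : N →ₗ[Rᵐᵒᵖ] N'} {g : M →ₗ[R] M'}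
    (hf : Function.Surjective f) (hg : Function.Surjective g) {t : Tens R N M}
    (ht : tensMap f g t = 0) : ∃ s : N ⊗[ℤ] M, (balancedRel R N M).mkQ s = t ∧
      TensorProduct.map f.toAddMonoidHom.toIntLinearMap g.toAddMonoidHom.toIntLinearMap s = 0 := by
  have hlift : ∀ b ∈ balancedRel R N' M', ∃ a ∈ balancedRel R N M,
      TensorProduct.map f.toAddMonoidHom.toIntLinearMap g.toAddMonoidHom.toIntLinearMap a = b := by
    intro b hb
    suffices balancedRel R N' M' ≤ (balancedRel R N M).map
        (TensorProduct.map f.toAddMonoidHom.toIntLinearMap g.toAddMonoidHom.toIntLinearMap) from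
      this hb
    refine Submodule.span_le.2 ?_
    rintro _ ⟨r, n, m, rfl⟩
    obtain ⟨n, rfl⟩ := hf n
    obtain ⟨m, rfl⟩ := hg m
    exact ⟨_, Submodule.subset_span ⟨r, n, m, rfl⟩, by simp⟩
  obtain ⟨s, rfl⟩ := Submodule.mkQ_surjective _ t
  obtain ⟨a, ha, hab⟩ := hlift
    (TensorProduct.map f.toAddMonoidHom.toIntLinearMap g.toAddMonoidHom.toIntLinearMap s)
    ((Submodule.Quotient.mk_eq_zero _).1 ht)
  refine ⟨s - a, ?_, by rw [map_sub, hab, sub_self]⟩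
  rw [map_sub, sub_eq_self]
  simpa using ha

/-- Right exactness descends from ⊗ over ℤ: the element has a representative already killed there.
-/
theorem tensMap_exact_right (N : Type u) [AddCommGroup N] [Module Rᵐᵒᵖ N] {g : M →ₗ[R] M'}
    {h : M' →ₗ[R] M''} (hgh : Function.Exact g h) (hh : Function.Surjective h)
    {t : Tens R N M'} (ht : tensMap (LinearMap.id : N →ₗ[Rᵐᵒᵖ] N) h t = 0) :
    ∃ s, tensMap (LinearMap.id : N →ₗ[Rᵐᵒᵖ] N) g s = t := by
  obtain ⟨a, rfl, ha⟩ := exists_rep_of_tensMap_eq_zero Function.surjective_id hh ht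
  have hex := lTensor_exact N (f := g.toAddMonoidHom.toIntLinearMap)
    (g := h.toAddMonoidHom.toIntLinearMap) hgh hh
  obtain ⟨b, rfl⟩ := (hex a).1 ha
  exact ⟨Submodule.mkQ _ b, rfl⟩

theorem tensMap_exact_left (M : Type u) [AddCommGroup M] [Module R M] {g : N →ₗ[Rᵐᵒᵖ] N'}
    {h : N' →ₗ[Rᵐᵒᵖ] N''} (hgh : Function.Exact g h) (hh : Function.Surjective h)
    {t : Tens R N' M} (ht : tensMap h (LinearMap.id : M →ₗ[R] M) t = 0) :
    ∃ s, tensMap g (LinearMap.id : M →ₗ[R] M) s = t := by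
  obtain ⟨a, rfl, ha⟩ := exists_rep_of_tensMap_eq_zero hh Function.surjective_id ht
  have hex := rTensor_exact M (f := g.toAddMonoidHom.toIntLinearMap)
    (g := h.toAddMonoidHom.toIntLinearMap) hgh hh
  obtain ⟨b, rfl⟩ := (hex a).1 ha
  exact ⟨Submodule.mkQ _ b, rfl⟩

/-- Free right modules are flat. -/
theorem tensMap_finsupp_injective (ι : Type u) {g : M →ₗ[R] M'} (hg : Function.Injective g) :
    Function.Injective (tensMap (LinearMap.id : (ι →₀ Rᵐᵒᵖ) →ₗ[Rᵐᵒᵖ] (ι →₀ Rᵐᵒᵖ)) g) := by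
  have key : ∀ (M : Type u) [AddCommGroup M] [Module R M], ∃ φ : Tens R (ι →₀ Rᵐᵒᵖ) M →ₗ[ℤ] (ι → M),
      (∀ p m i, φ (tmul R p m) i = (p i).unop • m) ∧ Function.Injective φ := by
    intro M _ _
    refine ⟨tensLift
      { toFun := fun p =>
          { toFun := fun m i => (p i).unop • m
            map_zero' := by ext; simp
            map_add' := fun m m' => by ext; simp }
        map_zero' := by ext; simp
        map_add' := fun p p' => by ext; simp [add_smul] }
      (fun r p m => by ext i; simp [mul_smul]), fun p m i => by simp, ?_⟩
    intro t t' htt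
    -- Every tensor has a normal form ∑ eᵢ ⊗ cᵢ, and the coordinate map reads off the cᵢ.
    have hsum : ∀ t : Tens R (ι →₀ Rᵐᵒᵖ) M, ∃ c : ι →₀ M,
        t = c.sum fun i m => tmul R (Finsupp.single i (1 : Rᵐᵒᵖ)) m := by
      classical
      intro t
      induction t using tens_induction with
      | h0 => exact ⟨0, by simp⟩
      | ha x y hx hy =>
        obtain ⟨c, rfl⟩ := hx
        obtain ⟨c', rfl⟩ := hy
        exact ⟨c + c', (Finsupp.sum_add_index' (fun i => tmul_zero _)
          (fun i => tmul_add _)).symm⟩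
      | ht p m =>
        induction p using Finsupp.induction_linear with
        | zero => exact ⟨0, by simp [zero_tmul]⟩
        | add p q hp hq =>
          obtain ⟨c, hc⟩ := hp
          obtain ⟨c', hc'⟩ := hq
          exact ⟨c + c', by rw [add_tmul, hc, hc', Finsupp.sum_add_index' (fun i => tmul_zero _)
            (fun i => tmul_add _)]⟩
        | single i a =>
          refine ⟨Finsupp.single i (a.unop • m), ?_⟩
          rw [Finsupp.sum_single_index (h := fun i m => tmul R (Finsupp.single i (1 : Rᵐᵒᵖ)) m)
            (tmul_zero _), ← op_smul_tmul]
          simp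
    obtain ⟨c, rfl⟩ := hsum t
    obtain ⟨c', rfl⟩ := hsum t'
    suffices c = c' by rw [this]
    ext i
    have := congrFun htt i
    simp only [Finsupp.sum, map_sum, tensLift_tmul, Finset.sum_apply] at this
    have heval : ∀ c : ι →₀ M,
        ∑ j ∈ c.support, ((Finsupp.single j (1 : Rᵐᵒᵖ)) i).unop • c j = c i := by
      intro c
      rw [Finset.sum_eq_single i]
      · simp
      · intro j _ hj
        simp [Finsupp.single_eq_of_ne' hj]
      · intro hi
        simp [Finsupp.notMem_support_iff.1 hi]
    exact (heval c).symm.trans (this.trans (heval c'))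
  obtain ⟨φ, hφ, hφi⟩ := key M
  obtain ⟨φ', hφ', -⟩ := key M'
  have hnat : ∀ t i, φ' (tensMap LinearMap.id g t) i = g (φ t i) := by
    intro t i
    induction t using tens_induction with
    | h0 => simp
    | ht p m => simp [hφ, hφ']
    | ha x y hx hy => simp [hx, hy]
  intro t t' htt
  refine hφi (funext fun i => hg ?_)
  rw [← hnat, ← hnat, htt]

/-- An extension by a flat module is pure. -/
theorem tensMap_injective_of_flat (N : Type u) [AddCommGroup N] [Module Rᵐᵒᵖ N] {i : M →ₗ[R] M'}
    {p : M' →ₗ[R] M''} (hi : Function.Injective i) (hip : Function.Exact i p)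
    (hp : Function.Surjective p) (hflat : IsFlat R M'') :
    Function.Injective (tensMap (LinearMap.id : N →ₗ[Rᵐᵒᵖ] N) i) := by
  -- Diagram chase along 0 → K → P → N → 0: flatness of M'' makes K ⊗ M'' → P ⊗ M'' injective, so
  -- the defect in K ⊗ M' comes from K ⊗ M. The claim for N follows from that for P, later taken
  -- free.
  have key : ∀ {P K : Type u} [AddCommGroup P] [Module Rᵐᵒᵖ P] [AddCommGroup K] [Module Rᵐᵒᵖ K]
      (κ : K →ₗ[Rᵐᵒᵖ] P) (π : P →ₗ[Rᵐᵒᵖ] N), Function.Injective κ → Function.Exact κ π →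
      Function.Surjective π →
      Function.Injective (tensMap (LinearMap.id : P →ₗ[Rᵐᵒᵖ] P) i) →
      Function.Injective (tensMap (LinearMap.id : N →ₗ[Rᵐᵒᵖ] N) i) := by
    intro P K _ _ _ _ κ π hκ hκπ hπ hP
    rw [injective_iff_map_eq_zero]
    intro x hx
    obtain ⟨y, rfl⟩ := tensMap_surjective (g := (LinearMap.id : M →ₗ[R] M)) hπ
      Function.surjective_id x
    obtain ⟨z, hz⟩ := tensMap_exact_left M' hκπ hπ
      (t := tensMap (LinearMap.id : P →ₗ[Rᵐᵒᵖ] _) i y)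
      (by rw [← hx]; simp only [tensMap_tensMap]; rfl)
    have hpi : p ∘ₗ i = 0 := hip.linearMap_comp_eq_zero
    have hz0 : tensMap (LinearMap.id : K →ₗ[Rᵐᵒᵖ] _) p z = 0 := by
      apply hflat κ hκ
      rw [map_zero, tensMap_tensMap]
      have := congrArg (tensMap (LinearMap.id : P →ₗ[Rᵐᵒᵖ] _) p) hz
      rw [tensMap_tensMap, tensMap_tensMap, hpi, tensMap_zero_right, LinearMap.zero_apply] at this
      exact this
    obtain ⟨w, rfl⟩ := tensMap_exact_right _ hip hp hz0
    have hwy : tensMap κ LinearMap.id w = y := by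
      apply hP
      rw [← hz]; simp only [tensMap_tensMap]; rfl
    rw [← hwy, tensMap_tensMap, hκπ.linearMap_comp_eq_zero, tensMap_zero_left,
      LinearMap.zero_apply]
  let π : (N →₀ Rᵐᵒᵖ) →ₗ[Rᵐᵒᵖ] N := Finsupp.linearCombination Rᵐᵒᵖ id
  refine key (P := N →₀ Rᵐᵒᵖ) (K := LinearMap.ker π) (LinearMap.ker π).subtype π Subtype.val_injective (fun x => ?_)
    (Finsupp.linearCombination_id_surjective _ _) (tensMap_finsupp_injective N hi)
  simp

end TensorLemmas
-- Closure properties of flat modules.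
section FlatLemmas

variable {R : Type u} [Ring R]
variable {M M' M'' : Type u} [AddCommGroup M] [Module R M] [AddCommGroup M'] [Module R M']
  [AddCommGroup M''] [Module R M'']

theorem tensMap_id_right_comm {N N' : Type u} [AddCommGroup N] [Module Rᵐᵒᵖ N] [AddCommGroup N']
    [Module Rᵐᵒᵖ N'] (f : N →ₗ[Rᵐᵒᵖ] N') (g : M →ₗ[R] M') (t : Tens R N M) :
    tensMap f LinearMap.id (tensMap LinearMap.id g t) =
      tensMap LinearMap.id g (tensMap f LinearMap.id t) := by
  simp only [tensMap_tensMap]; rfl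

theorem IsFlat.of_retract (h : IsFlat R M') (j : M →ₗ[R] M') (q : M' →ₗ[R] M)
    (hqj : q ∘ₗ j = LinearMap.id) : IsFlat R M := by
  intro N N' _ _ _ _ f hf
  rw [injective_iff_map_eq_zero]
  intro t ht
  have h1 : tensMap (LinearMap.id : N →ₗ[Rᵐᵒᵖ] N) j t = 0 := by
    apply h f hf
    rw [tensMap_id_right_comm, ht, map_zero, map_zero]
  have h2 := congrArg (tensMap (LinearMap.id : N →ₗ[Rᵐᵒᵖ] N) q) h1
  rwa [tensMap_tensMap, hqj, map_zero, LinearMap.comp_id, tensMap_id, LinearMap.id_apply] at h2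

theorem IsFlat.of_equiv (h : IsFlat R M') (e : M ≃ₗ[R] M') : IsFlat R M :=
  h.of_retract e e.symm (by ext; simp)

theorem IsFlat.prod (h : IsFlat R M) (h' : IsFlat R M') : IsFlat R (M × M') := by
  intro N N' _ _ _ _ f hf
  rw [injective_iff_map_eq_zero]
  intro t ht
  have h1 : tensMap (LinearMap.id : N →ₗ[Rᵐᵒᵖ] N) (LinearMap.fst R M M') t = 0 := by
    apply h f hf
    rw [tensMap_id_right_comm, ht, map_zero, map_zero]
  have h2 : tensMap (LinearMap.id : N →ₗ[Rᵐᵒᵖ] N) (LinearMap.snd R M M') t = 0 := by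
    apply h' f hf
    rw [tensMap_id_right_comm, ht, map_zero, map_zero]
  have h3 : LinearMap.inl R M M' ∘ₗ LinearMap.fst R M M' +
      LinearMap.inr R M M' ∘ₗ LinearMap.snd R M M' = LinearMap.id := by ext <;> simp
  have h4 : t = tensMap LinearMap.id (LinearMap.inl R M M' ∘ₗ LinearMap.fst R M M' +
      LinearMap.inr R M M' ∘ₗ LinearMap.snd R M M') t := by rw [h3, tensMap_id]; rfl
  rw [h4, tensMap_add_right, LinearMap.add_apply]
  have h5 := congrArg (tensMap (LinearMap.id : N →ₗ[Rᵐᵒᵖ] N) (LinearMap.inl R M M')) h1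
  have h6 := congrArg (tensMap (LinearMap.id : N →ₗ[Rᵐᵒᵖ] N) (LinearMap.inr R M M')) h2
  rw [tensMap_tensMap, map_zero, LinearMap.comp_id] at h5 h6
  rw [h5, h6, add_zero]

theorem IsFlat.finsupp (ι : Type u) (h : IsFlat R M) : IsFlat R (ι →₀ M) := by
  intro N N' _ _ _ _ f hf
  rw [injective_iff_map_eq_zero]
  intro t ht
  have h1 : ∀ i, tensMap (LinearMap.id : N →ₗ[Rᵐᵒᵖ] N)
      (Finsupp.lapply i : (ι →₀ M) →ₗ[R] M) t = 0 := by
    intro i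
    apply h f hf
    rw [tensMap_id_right_comm, ht, map_zero, map_zero]
  have h2 : ∀ t : Tens R N (ι →₀ M),
      (∀ i, tensMap (LinearMap.id : N →ₗ[Rᵐᵒᵖ] N) (Finsupp.lapply i : (ι →₀ M) →ₗ[R] M) t = 0) →
      t ∈ AddSubgroup.closure (Set.range fun x : ι × N × M =>
        tmul R x.2.1 (Finsupp.single x.1 x.2.2)) → t = 0 := by
    classical
    intro t h1 ht
    suffices ∃ S : Finset ι, t = ∑ i ∈ S, tensMap (LinearMap.id : N →ₗ[Rᵐᵒᵖ] N)
        (Finsupp.lsingle i : M →ₗ[R] (ι →₀ M)) (tensMap (LinearMap.id : N →ₗ[Rᵐᵒᵖ] N)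
          (Finsupp.lapply i : (ι →₀ M) →ₗ[R] M) t) by
      obtain ⟨S, hS⟩ := this
      rw [hS]
      exact Finset.sum_eq_zero fun i _ => by rw [h1, map_zero]
    -- Asking for all larger T lets the finite sets of two summands be merged by a union.
    suffices ∃ S : Finset ι, ∀ T, S ⊆ T →
        t = ∑ i ∈ T, tensMap (LinearMap.id : N →ₗ[Rᵐᵒᵖ] N)
        (Finsupp.lsingle i : M →ₗ[R] (ι →₀ M)) (tensMap (LinearMap.id : N →ₗ[Rᵐᵒᵖ] N)
          (Finsupp.lapply i : (ι →₀ M) →ₗ[R] M) t) from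
      this.imp fun S hS => hS S subset_rfl
    clear h1
    induction ht using AddSubgroup.closure_induction with
    | zero => exact ⟨∅, fun T _ => by simp⟩
    | mem x hx =>
      obtain ⟨⟨i, n, m⟩, rfl⟩ := hx
      refine ⟨{i}, fun T hT => ?_⟩
      rw [Finset.sum_eq_single i]
      · simp
      · intro j _ hj
        simp [Finsupp.single_eq_of_ne hj, tmul_zero]
      · intro hi
        exact absurd (hT (Finset.mem_singleton_self i)) hi
    | add x y _ _ hx hy =>
      obtain ⟨S, hS⟩ := hx
      obtain ⟨S', hS'⟩ := hy
      refine ⟨S ∪ S', fun T hT => ?_⟩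
      simp only [map_add, Finset.sum_add_distrib]
      rw [← hS T (Finset.union_subset_left hT), ← hS' T (Finset.union_subset_right hT)]
    | neg x _ hx =>
      obtain ⟨S, hS⟩ := hx
      refine ⟨S, fun T hT => ?_⟩
      simp only [map_neg, Finset.sum_neg_distrib]
      rw [← hS T hT]
  refine h2 t h1 ?_
  clear h1 ht
  induction t using tens_induction with
  | h0 => exact zero_mem _
  | ha x y hx hy => exact add_mem hx hy
  | ht n m =>
    induction m using Finsupp.induction_linear with
    | zero => rw [tmul_zero]; exact zero_mem _
    | add p q hp hq => rw [tmul_add]; exact add_mem hp hq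
    | single i a => exact AddSubgroup.subset_closure ⟨(i, n, a), rfl⟩

variable (R) in
theorem isFlat_self : IsFlat R R := by
  -- N ⊗ R is identified with N through t = φ(t) ⊗ 1.
  have key : ∀ (N : Type u) [AddCommGroup N] [Module Rᵐᵒᵖ N], ∃ φ : Tens R N R →ₗ[ℤ] N,
      (∀ n r, φ (tmul R n r) = MulOpposite.op r • n) ∧ ∀ t, t = tmul R (φ t) (1 : R) := by
    intro N _ _
    let φ : Tens R N R →ₗ[ℤ] N := tensLift
      { toFun := fun n =>
          { toFun := fun r => MulOpposite.op r • n
            map_zero' := by simp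
            map_add' := fun m m' => by simp [add_smul] }
        map_zero' := by ext; simp
        map_add' := fun p p' => by ext; simp }
      (fun r p m => by simp [mul_smul])
    have hφ : ∀ n r, φ (tmul R n r) = MulOpposite.op r • n := fun n r => by simp [φ]
    refine ⟨φ, hφ, fun t => ?_⟩
    induction t using tens_induction with
    | h0 => rw [map_zero, zero_tmul]
    | ht n r => rw [hφ, op_smul_tmul, smul_eq_mul, mul_one]
    | ha x y hx hy => rw [map_add, add_tmul, ← hx, ← hy]
  intro N N' _ _ _ _ f hf
  rw [injective_iff_map_eq_zero]
  intro t ht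
  obtain ⟨φ, -, h⟩ := key N
  obtain ⟨φ', hφ', -⟩ := key N'
  rw [h t] at ht ⊢
  rw [tensMap_tmul] at ht
  have := congrArg φ' ht
  rw [hφ', map_zero, LinearMap.id_apply, MulOpposite.op_one, one_smul] at this
  rw [hf (this.trans (map_zero f).symm), zero_tmul]

theorem isFlat_of_subsingleton [Subsingleton M] : IsFlat R M :=
  (isFlat_self R).of_retract 0 0 (LinearMap.ext fun _ => Subsingleton.elim _ _)

/-- N ⊗ M → N ⊗ M' is injective by purity and N ⊗ M' → N' ⊗ M' by flatness; their composite factors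
through N ⊗ M → N' ⊗ M. -/
theorem IsFlat.of_exact (hQ : IsFlat R M') (hG : IsFlat R M'') {i : M →ₗ[R] M'} {p : M' →ₗ[R] M''}
    (hi : Function.Injective i) (hip : Function.Exact i p) (hp : Function.Surjective p) :
    IsFlat R M := by
  intro N N' _ _ _ _ f hf
  rw [injective_iff_map_eq_zero]
  intro t ht
  apply tensMap_injective_of_flat N hi hip hp hG
  apply hQ f hf
  rw [tensMap_id_right_comm, ht]
  simp only [map_zero]

end FlatLemmas

/-! ### Flat dimension through syzygies. -/

section FlatDimension

variable (R : Type u) [Ring R]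

/-- `M` has flat dimension at most `n`, by recursion on `n`: it is flat, or is the quotient of a
flat module by a submodule of flat dimension at most `n - 1`. -/
def SyzygyFlatDimLE : ℕ → ∀ (M : Type u) [AddCommGroup M] [Module R M], Prop
  | 0, M, _, _ => IsFlat R M
  | n + 1, M, _, _ => ∃ (K G : ModuleCat.{u} R) (i : K →ₗ[R] G) (p : G →ₗ[R] M),
      IsFlat R G ∧ SyzygyFlatDimLE n K ∧ Function.Injective i ∧ Function.Exact i p ∧
        Function.Surjective p

variable {R}

theorem SyzygyFlatDimLE.succ {n : ℕ} {K G M : Type u} [AddCommGroup K] [Module R K]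
    [AddCommGroup G] [Module R G] [AddCommGroup M] [Module R M] (hK : SyzygyFlatDimLE R n K)
    (hG : IsFlat R G) {i : K →ₗ[R] G} {p : G →ₗ[R] M} (hi : Function.Injective i)
    (hip : Function.Exact i p) (hp : Function.Surjective p) : SyzygyFlatDimLE R (n + 1) M :=
  ⟨ModuleCat.of R K, ModuleCat.of R G, i, p, hG, hK, hi, hip, hp⟩

theorem SyzygyFlatDimLE.prod_flat {n : ℕ} {M F : Type u} [AddCommGroup M] [Module R M]
    [AddCommGroup F] [Module R F] (h : SyzygyFlatDimLE R n M) (hF : IsFlat R F) :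
    SyzygyFlatDimLE R n (M × F) := by
  cases n with
  | zero => exact IsFlat.prod h hF
  | succ n =>
    obtain ⟨K, G, i, p, hG, hK, hi, hip, hp⟩ := h
    refine hK.succ (hG.prod hF) (i := LinearMap.inl R G F ∘ₗ i)
      (p := p.prodMap LinearMap.id) (LinearMap.inl_injective.comp hi) ?_
      (hp.prodMap Function.surjective_id)
    rintro ⟨x, y⟩
    simp only [LinearMap.prodMap_apply, LinearMap.id_apply, Prod.mk_eq_zero, hip x, Set.mem_range,
      LinearMap.comp_apply, LinearMap.inl_apply, Prod.mk.injEq, exists_and_right]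
    rw [@eq_comm _ y]

/-- The kernel of a surjection onto a flat module has no larger flat dimension. -/
theorem SyzygyFlatDimLE.of_exact {n : ℕ} : ∀ {K Q G : Type u} [AddCommGroup K] [Module R K]
    [AddCommGroup Q] [Module R Q] [AddCommGroup G] [Module R G] (_ : SyzygyFlatDimLE R n Q)
    (_ : IsFlat R G) {i : K →ₗ[R] Q} {p : Q →ₗ[R] G} (_ : Function.Injective i)
    (_ : Function.Exact i p) (_ : Function.Surjective p), SyzygyFlatDimLE R n K := by
  intro K Q G _ _ _ _ _ _ hQ hG i p hi hip hp
  cases n with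
  | zero => exact IsFlat.of_exact hQ hG hi hip hp
  | succ n =>
    obtain ⟨Q', H, j, h, hH, hQ', hj, hjh, hh⟩ := hQ
    let e := LinearEquiv.ofInjective i hi
    have hie : ∀ y, i (e.symm y) = y := fun y => congrArg Subtype.val (e.apply_symm_apply y)
    -- Restrict H → Q to the preimage of K. That preimage is the kernel of H → G, hence flat, and it
    -- maps onto K with the same kernel Q'.
    let π : LinearMap.ker (p ∘ₗ h) →ₗ[R] K := e.symm.toLinearMap ∘ₗ
      (h ∘ₗ (LinearMap.ker (p ∘ₗ h)).subtype).codRestrict (LinearMap.range i)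
        (fun x => (hip _).1 x.2)
    have hπ : ∀ x, i (π x) = h x := fun x => hie _
    refine hQ'.succ (G := LinearMap.ker (p ∘ₗ h))
      (hH.of_exact hG (p := p ∘ₗ h) Subtype.val_injective (LinearMap.exact_subtype_ker_map _)
        (hp.comp hh))
      (i := j.codRestrict _ (fun x => by simp [hjh.apply_apply_eq_zero])) (p := π) ?_ ?_ ?_
    · intro x y hxy
      exact hj (congrArg Subtype.val hxy)
    · intro x
      rw [← hi.eq_iff, hπ, map_zero, hjh x]
      exact ⟨fun ⟨y, hy⟩ => ⟨y, Subtype.ext hy⟩, fun ⟨y, hy⟩ => ⟨y, congrArg Subtype.val hy⟩⟩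
    · intro k
      obtain ⟨x, hx⟩ := hh (i k)
      refine ⟨⟨x, ?_⟩, hi ?_⟩
      · simp [hx, hip.apply_apply_eq_zero]
      · rw [hπ, hx]

/-- Any syzygy with respect to a flat projective module has smaller flat dimension. -/
theorem SyzygyFlatDimLE.syzygy {n : ℕ} {K F P : Type u} [AddCommGroup K] [Module R K]
    [AddCommGroup F] [Module R F] [AddCommGroup P] [Module R P]
    (hP : SyzygyFlatDimLE R (n + 1) P) [Module.Projective R F] (hF : IsFlat R F) {i : K →ₗ[R] F}
    {p : F →ₗ[R] P} (hi : Function.Injective i) (hip : Function.Exact i p)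
    (hp : Function.Surjective p) : SyzygyFlatDimLE R n K := by
  obtain ⟨K', G, i', g, hG, hK', hi', hig', hg⟩ := hP
  obtain ⟨s, hs⟩ := Module.projective_lifting_property g p hg
  have hs : ∀ x, g (s x) = p x := fun x => LinearMap.congr_fun hs x
  let e := LinearEquiv.ofInjective i' hi'
  have hie : ∀ y, i' (e.symm y) = y := fun y => congrArg Subtype.val (e.apply_symm_apply y)
  let c : K →ₗ[R] K' := e.symm.toLinearMap ∘ₗ
    (s ∘ₗ i).codRestrict (LinearMap.range i') (fun x => (hig' _).1 (by
      simp [hs, hip.apply_apply_eq_zero]))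
  have hc : ∀ x, i' (c x) = s (i x) := fun x => hie _
  -- Schanuel: the lift s yields an exact sequence 0 → K → K' × F → G → 0 with G flat. The sign of c
  -- makes the composite vanish.
  refine (hK'.prod_flat hF).of_exact hG (i := (-c).prod i) (p := i'.coprod s) ?_ ?_ ?_
  · intro x y hxy
    exact hi (congrArg Prod.snd hxy)
  · rintro ⟨k, f⟩
    constructor
    · intro h
      have h : i' k + s f = 0 := by simpa using h
      have hf : p f = 0 := by
        rw [← hs, eq_neg_of_add_eq_zero_right h, map_neg, hig'.apply_apply_eq_zero, neg_zero]
      obtain ⟨x, rfl⟩ := (hip f).1 hf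
      refine ⟨x, Prod.ext (hi' ?_) rfl⟩
      simp [hc, eq_neg_of_add_eq_zero_left h]
    · rintro ⟨x, hx⟩
      rw [← hx]
      simp [hc]
  · intro y
    obtain ⟨f, hf⟩ := hp (g y)
    obtain ⟨k, hk⟩ := (hig' (y - s f)).1 (by rw [map_sub, hs, hf, sub_self])
    exact ⟨(k, f), by simp [hk]⟩

/-- Free covers of M and P are chosen so that the syzygy of M is a retract of that of P; induction
then applies. -/
theorem SyzygyFlatDimLE.of_retract {n : ℕ} : ∀ {M P : Type u} [AddCommGroup M] [Module R M]
    [AddCommGroup P] [Module R P] (_ : SyzygyFlatDimLE R n P) (j : M →ₗ[R] P) (q : P →ₗ[R] M)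
    (_ : ∀ x, q (j x) = x), SyzygyFlatDimLE R n M := by
  induction n with
  | zero =>
    intro M P _ _ _ _ h j q hqj
    exact IsFlat.of_retract h j q (LinearMap.ext hqj)
  | succ n ih =>
    intro M P _ _ _ _ h j q hqj
    let p : (M →₀ R) →ₗ[R] M := Finsupp.linearCombination R id
    have hp : Function.Surjective p := Finsupp.linearCombination_id_surjective _ _
    let π : (P →₀ R) →ₗ[R] P := Finsupp.linearCombination R id
    have hπ : Function.Surjective π := Finsupp.linearCombination_id_surjective _ _
    -- The first factor covers j(M), the second the complement ker q. Since q ∘ τ = p ∘ fst, `inl`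
    -- and `fst` restrict to maps between ker p and ker τ.
    let τ : (M →₀ R) × (P →₀ R) →ₗ[R] P := (j ∘ₗ p).coprod (π - j ∘ₗ q ∘ₗ π)
    have hτ : ∀ a b, τ (a, b) = j (p a) + (π b - j (q (π b))) := fun a b => by simp [τ]
    have hqτ : ∀ x, q (τ x) = p x.1 := fun x => by rw [hτ]; simp [hqj]
    have hτs : Function.Surjective τ := by
      intro y
      obtain ⟨a, ha⟩ := hp (q y)
      obtain ⟨b, hb⟩ := hπ y
      exact ⟨(a, b), by rw [hτ, ha, hb]; abel⟩
    have hK : SyzygyFlatDimLE R n (LinearMap.ker τ) :=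
      h.syzygy (((isFlat_self R).finsupp M).prod ((isFlat_self R).finsupp P))
        Subtype.val_injective (LinearMap.exact_subtype_ker_map τ) hτs
    refine SyzygyFlatDimLE.succ (K := LinearMap.ker p) (ih hK
      ((LinearMap.inl R _ _ ∘ₗ (LinearMap.ker p).subtype).codRestrict _ fun x => ?_)
      ((LinearMap.fst R _ _ ∘ₗ (LinearMap.ker τ).subtype).codRestrict _ fun x => ?_)
      (fun x => ?_)) ((isFlat_self R).finsupp M) Subtype.val_injective
      (LinearMap.exact_subtype_ker_map p) hp
    · have := x.2
      rw [LinearMap.mem_ker] at this ⊢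
      simp [hτ, this]
    · have := hqτ x
      rw [x.2, map_zero] at this
      exact this.symm
    · rfl

theorem SyzygyFlatDimLE.finsupp {n : ℕ} (ι : Type u) : ∀ {M : Type u} [AddCommGroup M]
    [Module R M] (_ : SyzygyFlatDimLE R n M), SyzygyFlatDimLE R n (ι →₀ M) := by
  induction n with
  | zero =>
    intro M _ _ h
    exact IsFlat.finsupp ι h
  | succ n ih =>
    intro M _ _ h
    obtain ⟨K, G, i, p, hG, hK, hi, hip, hp⟩ := h
    refine (ih hK).succ (hG.finsupp ι) (i := Finsupp.mapRange.linearMap i)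
      (p := Finsupp.mapRange.linearMap p) (Finsupp.mapRange_injective _ (map_zero i) hi) ?_
      (Finsupp.mapRange_surjective _ (map_zero p) hp)
    intro x
    constructor
    · intro hx
      have hx : ∀ a, ∃ k, i k = x a := fun a => (hip _).1 (DFunLike.congr_fun hx a)
      choose c hc using hx
      refine ⟨Finsupp.onFinset x.support c fun a ha => ?_, Finsupp.ext fun a => hc a⟩
      rw [Finsupp.mem_support_iff, ← hc]
      exact fun h0 => ha (hi (by rw [h0, map_zero]))
    · rintro ⟨y, rfl⟩
      ext a
      exact hip.apply_apply_eq_zero _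

/-- Dropping `F 0` and shifting leaves a resolution of ker ε, shorter by one. -/
theorem HasFlatDimLE.syzygyFlatDimLE {n : ℕ} : ∀ {M : Type u} [AddCommGroup M] [Module R M],
    HasFlatDimLE R M n → SyzygyFlatDimLE R n M := by
  induction n with
  | zero =>
    intro M _ _ h
    obtain ⟨F, d, ε, hF, h0, hε, hd, -⟩ := h
    have : Subsingleton (F 1) := h0 1 one_pos
    refine (hF 0).of_equiv (LinearEquiv.ofBijective ε ⟨?_, hε⟩).symm
    rw [injective_iff_map_eq_zero]
    intro x hx
    obtain ⟨y, rfl⟩ := (hd x).1 hx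
    rw [Subsingleton.elim y 0, map_zero]
  | succ n ih =>
    intro M _ _ h
    obtain ⟨F, d, ε, hF, h0, hε, hd, hdd⟩ := h
    refine SyzygyFlatDimLE.succ (K := LinearMap.ker ε) (ih ?_) (hF 0) Subtype.val_injective
      (LinearMap.exact_subtype_ker_map ε) hε
    refine ⟨fun k => F (k + 1), fun k => d (k + 1),
      (d 0).codRestrict _ fun x => hd.apply_apply_eq_zero x, fun k => hF _,
      fun k hk => h0 _ (by omega), ?_, ?_, fun k => hdd _⟩
    · rintro ⟨x, hx⟩
      obtain ⟨y, rfl⟩ := (hd x).1 hx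
      exact ⟨y, rfl⟩
    · intro x
      rw [← hdd 0 x]
      exact Subtype.ext_iff

theorem SyzygyFlatDimLE.hasFlatDimLE {n : ℕ} : ∀ {M : Type u} [AddCommGroup M] [Module R M],
    SyzygyFlatDimLE R n M → HasFlatDimLE R M n := by
  induction n with
  | zero =>
    intro M _ _ h
    refine ⟨fun k => Nat.casesOn k (ModuleCat.of R M) fun _ => ModuleCat.of R PUnit,
      fun k => 0, LinearMap.id, ?_, ?_, Function.surjective_id, ?_, ?_⟩
    · rintro (_ | k)
      · exact h
      · exact isFlat_of_subsingleton (M := PUnit)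
    · rintro (_ | k) hk
      · omega
      · exact inferInstanceAs (Subsingleton PUnit)
    · intro x
      exact ⟨fun hx => ⟨0, hx.symm⟩, fun ⟨_, hx⟩ => hx.symm⟩
    · intro k x
      exact ⟨fun _ => ⟨0, rfl⟩, fun _ => rfl⟩
  | succ n ih =>
    intro M _ _ h
    obtain ⟨K, G, i, p, hG, hK, hi, hip, hp⟩ := h
    obtain ⟨F, d, ε, hF, h0, hε, hd, hdd⟩ := ih hK
    refine ⟨fun k => Nat.casesOn k G F, fun k => Nat.casesOn k (i ∘ₗ ε) d, p, ?_, ?_, hp, ?_, ?_⟩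
    · rintro (_ | k)
      · exact hG
      · exact hF k
    · rintro (_ | k) hk
      · omega
      · exact h0 k (by omega)
    · intro x
      rw [hip x]
      exact ⟨fun ⟨y, hy⟩ => (hε y).imp fun z hz => by rw [← hy, ← hz]; rfl,
        fun ⟨z, hz⟩ => ⟨ε z, hz⟩⟩
    · rintro (_ | k)
      · intro x
        rw [← hd x]
        exact ⟨fun hx => hi (hx.trans (map_zero i).symm),
          fun hx => (congrArg i hx).trans (map_zero i)⟩
      · exact hdd k

/-- Injectivity of B splits j. The two layers of direct sum match the application: κ indexes
coordinates of a free module, ι the cyclic summands. -/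
theorem flatDim_le_of_embedding {A B : Type u} [AddCommGroup A] [Module R A] [AddCommGroup B]
    [Module R B] (hB : Module.Injective R B) {ι κ : Type u} (j : B →ₗ[R] (ι →₀ κ →₀ A))
    (hj : Function.Injective j) : flatDim R B ≤ flatDim R A := by
  obtain ⟨q, hq⟩ := hB.out j hj LinearMap.id
  refine le_iInf₂ fun n hn => iInf₂_le n ?_
  exact (((hn.syzygyFlatDimLE.finsupp κ).finsupp ι).of_retract j q hq).hasFlatDimLE

end FlatDimension

/-! ### Embedding injective envelopes into direct sums of E⁰(R). -/

section Embedding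

variable {R : Type u} [Ring R]

/-- Over a left Noetherian ring direct sums of copies of an injective module are injective. -/
theorem injective_finsupp [IsNoetherianRing R] (ι : Type u) {E : Type u} [AddCommGroup E]
    [Module R E] (hE : Module.Injective R E) : Module.Injective R (ι →₀ E) := by
  classical
  refine Module.Baer.injective fun I g => ?_
  have h1 : ∀ i, ∃ e : E, ∀ x : I, g x i = (x : R) • e := by
    intro i
    obtain ⟨h, hh⟩ := hE.out I.subtype Subtype.val_injective (Finsupp.lapply i ∘ₗ g)
    refine ⟨h 1, fun x => ?_⟩
    rw [← map_smul, smul_eq_mul, mul_one]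
    exact (hh x).symm
  choose e he using h1
  obtain ⟨S, hS⟩ := (Module.Finite.fg_top : (⊤ : Submodule R I).FG)
  -- Baer's criterion: the finitely many generators of I involve only finitely many coordinates, so
  -- the coordinatewise extensions assemble to a finitely supported element.
  let T : Finset ι := S.biUnion fun x => (g x).support
  have hT : ∀ i ∉ T, ∀ x : I, g x i = 0 := by
    intro i hi x
    have : (⊤ : Submodule R I) ≤ LinearMap.ker (Finsupp.lapply i ∘ₗ g) := by
      rw [← hS, Submodule.span_le]
      intro y hy
      by_contra hne
      exact hi (Finset.mem_biUnion.2 ⟨y, hy, Finsupp.mem_support_iff.2 hne⟩)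
    exact this Submodule.mem_top
  refine ⟨LinearMap.toSpanSingleton R _ (Finsupp.indicator T fun i _ => e i), fun x mem => ?_⟩
  ext i
  rw [LinearMap.toSpanSingleton_apply, Finsupp.smul_apply, Finsupp.indicator_apply]
  split_ifs with hi
  · exact (he i ⟨x, mem⟩).symm
  · rw [smul_zero, hT i hi]

/-- If `x` in a flat module is killed by `s` for all `s` in a finite set, then `x` is a combination
of elements `l • y` with `s * l = 0` for all those `s`. -/
theorem IsFlat.mem_closure_of_smul_eq_zero {F : Type u} [AddCommGroup F] [Module R F]
    (hF : IsFlat R F) (S : Finset R) (x : F) (hx : ∀ s ∈ S, s • x = 0) :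
    x ∈ AddSubgroup.closure {z : F | ∃ (l : R) (y : F), (∀ s ∈ S, s * l = 0) ∧ z = l • y} := by
  classical
  set B := AddSubgroup.closure {z : F | ∃ (l : R) (y : F), (∀ s ∈ S, s * l = 0) ∧ z = l • y}
  -- f is a ↦ (s a)ₛ, with kernel the right ideal L = {l | s l = 0 for all s ∈ S}. R/L embeds in
  -- R^S, where 1 ⊗ x goes to ∑ eₛ ⊗ s x = 0, so 1 ⊗ x = 0 in R/L ⊗ F by flatness.
  let f : Rᵐᵒᵖ →ₗ[Rᵐᵒᵖ] (S → Rᵐᵒᵖ) := LinearMap.pi fun s =>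
    LinearMap.toSpanSingleton Rᵐᵒᵖ Rᵐᵒᵖ (MulOpposite.op (s : R))
  have hf : ∀ a, f a = 0 ↔ ∀ s ∈ S, s * a.unop = 0 := by
    intro a
    simp [f, funext_iff, ← MulOpposite.unop_inj]
  let L := LinearMap.ker f
  let g : (Rᵐᵒᵖ ⧸ L) →ₗ[Rᵐᵒᵖ] (S → Rᵐᵒᵖ) := L.liftQ f le_rfl
  have hg : Function.Injective g := LinearMap.ker_eq_bot.1 (Submodule.ker_liftQ_eq_bot _ _ _ le_rfl)
  have h0 : tmul R (L.mkQ 1) x = 0 := by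
    apply hF g hg
    rw [tensMap_tmul, map_zero]
    have h1 : g (L.mkQ 1) = ∑ s : S, MulOpposite.op (s : R) •
        (Pi.single s 1 : S → Rᵐᵒᵖ) := by
      ext t
      simp [g, f, Pi.single_apply]
    rw [h1]
    let a : (S → Rᵐᵒᵖ) →+ Tens R (S → Rᵐᵒᵖ) F :=
      { toFun := fun n => tmul R n x
        map_zero' := zero_tmul x
        map_add' := fun n n' => add_tmul n n' x }
    change a _ = 0
    rw [map_sum]
    refine Finset.sum_eq_zero fun s _ => ?_
    change tmul R _ x = 0
    rw [op_smul_tmul, hx s s.2, tmul_zero]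
  -- B is L F, and R/L ⊗ F → F/LF sends 1 ⊗ x to the class of x.
  let φ : (Rᵐᵒᵖ ⧸ L) →+ F →+ (F ⧸ B) := QuotientAddGroup.lift L.toAddSubgroup
    { toFun := fun r => (QuotientAddGroup.mk' B).comp
        (DistribSMul.toAddMonoidHom F r.unop)
      map_zero' := by ext; simp
      map_add' := fun r r' => by ext; simp [add_smul] }
    (by
      intro r hr
      ext y
      have : r.unop • y ∈ B := AddSubgroup.subset_closure ⟨_, y, (hf r).1 hr, rfl⟩
      simpa using this)
  have hφ : ∀ r y, φ (L.mkQ r) y = QuotientAddGroup.mk' B (r.unop • y) := fun r y => rfl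
  have h2 := congrArg (tensLift φ (by
    intro r n y
    obtain ⟨n, rfl⟩ := L.mkQ_surjective n
    rw [← map_smul, hφ, hφ]
    simp [mul_smul])) h0
  rw [tensLift_tmul, hφ, map_zero] at h2
  simpa using h2

/-- A cyclic submodule of a flat module over a left Noetherian ring embeds in a free module. -/
theorem IsFlat.exists_smul_eq_zero_iff [IsNoetherianRing R] {F : Type u} [AddCommGroup F]
    [Module R F] (hF : IsFlat R F) (x : F) :
    ∃ c : R →₀ R, ∀ r : R, r • x = 0 ↔ r • c = 0 := by
  classical
  let I : Ideal R := LinearMap.ker (LinearMap.toSpanSingleton R F x)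
  obtain ⟨S, hS⟩ := IsNoetherian.noetherian I
  have hI : ∀ r, r ∈ I ↔ r • x = 0 := fun r => Iff.rfl
  have hSx : ∀ s ∈ S, s • x = 0 := fun s hs => (hI s).1 (hS ▸ Submodule.subset_span hs)
  have key : ∃ T : Finset R, (∀ l ∈ T, ∀ s ∈ S, s * l = 0) ∧
      ∀ r : R, (∀ l ∈ T, r * l = 0) → r • x = 0 := by
    have := hF.mem_closure_of_smul_eq_zero S x hSx
    clear hSx hI hS I
    induction this using AddSubgroup.closure_induction with
    | zero => exact ⟨∅, by simp, by simp⟩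
    | mem x hx =>
      obtain ⟨l, y, hl, rfl⟩ := hx
      refine ⟨{l}, by simpa using hl, fun r hr => ?_⟩
      rw [← mul_smul, hr l (Finset.mem_singleton_self l), zero_smul]
    | add x y _ _ hx hy =>
      obtain ⟨T, hT, hTx⟩ := hx
      obtain ⟨T', hT', hTy⟩ := hy
      refine ⟨T ∪ T', fun l hl => (Finset.mem_union.1 hl).elim (hT l) (hT' l), fun r hr => ?_⟩
      rw [smul_add, hTx r fun l hl => hr l (Finset.mem_union_left _ hl),
        hTy r fun l hl => hr l (Finset.mem_union_right _ hl), add_zero]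
    | neg x _ hx =>
      obtain ⟨T, hT, hTx⟩ := hx
      exact ⟨T, hT, fun r hr => by rw [smul_neg, hTx r hr, neg_zero]⟩
  obtain ⟨T, hT, hTx⟩ := key
  -- The tuple c is indexed by its own entries: coordinate l ∈ T has value l.
  refine ⟨Finsupp.indicator T fun l _ => l, fun r => ⟨fun hr => ?_, fun hr => hTx r ?_⟩⟩
  · have hr : r ∈ Submodule.span R (S : Set R) := hS ▸ (hI r).2 hr
    ext l
    rw [Finsupp.smul_apply, Finsupp.indicator_apply]
    split_ifs with hl
    · have : Submodule.span R (S : Set R) ≤ LinearMap.ker (LinearMap.toSpanSingleton R R l) :=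
        Submodule.span_le.2 fun s hs => hT l hl s hs
      exact this hr
    · simp
  · intro l hl
    have := DFunLike.congr_fun hr l
    rwa [Finsupp.smul_apply, Finsupp.indicator_apply, dif_pos hl] at this

theorem sSupIndep_insert {M : Type u} [AddCommGroup M] [Module R M] {s : Set (Submodule R M)}
    (hs : sSupIndep s) {U : Submodule R M} (hU : Disjoint U (sSup s)) :
    sSupIndep (insert U s) := by
  rintro x (rfl | hx)
  · exact hU.mono_right (sSup_le_sSup fun y hy => hy.1.resolve_left hy.2)
  · by_cases hxU : x = U
    · subst hxU
      exact hU.mono_right (sSup_le_sSup fun y hy => hy.1.resolve_left hy.2)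
    · have h1 : sSup (insert U s \ {x}) = U ⊔ sSup (s \ {x}) := by
        rw [Set.insert_sdiff_of_notMem _ (fun h => hxU (Set.mem_singleton_iff.1 h).symm),
          sSup_insert]
      rw [h1, sup_comm]
      refine (hs hx).disjoint_sup_right_of_disjoint_sup_left (hU.symm.mono_left ?_)
      exact sup_le (le_sSup hx) (sSup_le_sSup Set.sdiff_subset)

/-- Every module contains an essential direct sum of cyclic submodules. -/
theorem exists_sSupIndep_cyclic (M : Type u) [AddCommGroup M] [Module R M] :
    ∃ s : Set (Submodule R M), sSupIndep s ∧ (∀ U ∈ s, ∃ x, U = Submodule.span R {x}) ∧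
      ∀ V : Submodule R M, Disjoint V (sSup s) → V = ⊥ := by
  obtain ⟨s, hs⟩ := zorn_subset
    {s : Set (Submodule R M) | sSupIndep s ∧ ∀ U ∈ s, ∃ x, U = Submodule.span R {x}}
    (by
      intro c hc hch
      refine ⟨⋃₀ c, ⟨iSupIndep_sUnion_of_directed hch.directedOn fun a ha => (hc ha).1, ?_⟩,
        fun a ha => Set.subset_sUnion_of_mem ha⟩
      rintro U ⟨a, ha, hU⟩
      exact (hc ha).2 U hU)
  refine ⟨s, hs.prop.1, hs.prop.2, fun V hV => ?_⟩
  rw [Submodule.eq_bot_iff]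
  intro x hx
  have hxV : Submodule.span R {x} ≤ V := (Submodule.span_singleton_le_iff_mem x V).2 hx
  have hdisj := hV.mono_left hxV
  -- By maximality R x already belongs to the family; being also disjoint from its sum, it is zero.
  have hmem : Submodule.span R {x} ∈ s := hs.le_of_ge
    ⟨sSupIndep_insert hs.prop.1 hdisj, by
      rintro U (rfl | hU)
      · exact ⟨x, rfl⟩
      · exact hs.prop.2 U hU⟩ (Set.subset_insert _ _) (Set.mem_insert _ _)
  exact (Submodule.mem_bot R).1 (hdisj.eq_bot_of_le (le_sSup hmem) ▸
    Submodule.mem_span_singleton_self x)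

/-- If every cyclic submodule of `M` embeds in the injective module `J`, then the injective
envelope of `M` embeds in a direct sum of copies of `J`. -/
theorem exists_envelope_embedding [IsNoetherianRing R] {M E J : Type u} [AddCommGroup M]
    [Module R M] [AddCommGroup E] [Module R E] [AddCommGroup J] [Module R J] {i : M →ₗ[R] E}
    (hi : IsInjectiveEnvelope R i) (hJ : Module.Injective R J)
    (hM : ∀ x : M, ∃ c : J, ∀ r : R, r • x = 0 ↔ r • c = 0) :
    ∃ (ι : Type u) (j : E →ₗ[R] (ι →₀ J)), Function.Injective j := by
  classical
  obtain ⟨s, hs, hcyc, hess⟩ := exists_sSupIndep_cyclic (R := R) M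
  have hU : ∀ U : s, ∃ f : U.1 →ₗ[R] J, Function.Injective f := by
    rintro ⟨U, hU⟩
    obtain ⟨x, rfl⟩ := hcyc U hU
    obtain ⟨c, hc⟩ := hM x
    have hann : ∀ r, r ∈ LinearMap.ker (LinearMap.toSpanSingleton R M x) ↔ r • c = 0 := hc
    let f := (LinearMap.ker (LinearMap.toSpanSingleton R M x)).liftQ
      (LinearMap.toSpanSingleton R J c) (fun r hr => (hc r).1 hr)
    have hf : Function.Injective f := LinearMap.ker_eq_bot.1
      (Submodule.ker_liftQ_eq_bot _ _ _ fun r hr => (hc r).2 hr)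
    let e := (LinearMap.toSpanSingleton R M x).quotKerEquivRange
    refine ⟨f ∘ₗ e.symm.toLinearMap ∘ₗ Submodule.inclusion
      (LinearMap.range_toSpanSingleton (R := R) x).ge,
      hf.comp (e.symm.injective.comp (Submodule.inclusion_injective _))⟩
  choose f hf using hU
  let a : (Π₀ U : s, U.1) →ₗ[R] M := DFinsupp.lsum ℕ fun U => U.1.subtype
  have ha : Function.Injective a := ((sSupIndep_iff s).1 hs).dfinsupp_lsum_injective
  have har : LinearMap.range a = sSup s := by
    rw [sSup_eq_iSup', Submodule.iSup_eq_range_dfinsupp_lsum]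
  let b : (Π₀ U : s, U.1) →ₗ[R] (s →₀ J) :=
    (finsuppLequivDFinsupp R).symm.toLinearMap ∘ₗ DFinsupp.mapRange.linearMap f
  have hb : Function.Injective b := (finsuppLequivDFinsupp R).symm.injective.comp
    ((DFinsupp.mapRange_injective _ fun U => map_zero (f U)).2 hf)
  obtain ⟨j, hj⟩ := (injective_finsupp s hJ).out (i ∘ₗ a) (hi.injective_map.comp ha) b
  refine ⟨s, j, LinearMap.ker_eq_bot.1 (hi.essential _ ?_)⟩
  -- Essentiality is used twice: j is injective on the direct sum of cyclics, hence on M, hence on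
  -- E.
  have hker : (LinearMap.ker j).comap i = ⊥ := by
    refine hess _ ?_
    rw [← har, Submodule.disjoint_def]
    rintro _ hy ⟨t, rfl⟩
    have : b t = 0 := by rw [← hj]; exact hy
    rw [hb (this.trans (map_zero b).symm), map_zero]
  rw [Submodule.eq_bot_iff]
  rintro _ ⟨⟨y, rfl⟩, hy⟩
  have : y ∈ (LinearMap.ker j).comap i := hy
  rw [hker, Submodule.mem_bot] at this
  rw [this, map_zero]

/-- The injective envelope of a submodule of a flat module has flat dimension at most that of the
injective envelope of the ring. -/
theorem flatDim_injEnvelope_le [IsNoetherianRing R] {M F : Type u} [AddCommGroup M] [Module R M]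
    [AddCommGroup F] [Module R F] (hF : IsFlat R F) (g : M →ₗ[R] F) (hg : Function.Injective g) :
    flatDim R (injEnvelope R M) ≤ flatDim R (injEnvelope R R) := by
  have hE := injEnvelopeMap_spec R R
  have hM := injEnvelopeMap_spec R M
  obtain ⟨ι, j, hj⟩ := exists_envelope_embedding hM (injective_finsupp R hE.injective_module) (by
    intro x
    obtain ⟨c, hc⟩ := hF.exists_smul_eq_zero_iff (g x)
    refine ⟨Finsupp.mapRange.linearMap (injEnvelopeMap R R) c, fun r => ?_⟩
    rw [← map_smul, ← hg.eq_iff, map_smul, map_zero, hc r]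
    exact (map_eq_zero_iff _ (Finsupp.mapRange_injective _ (map_zero _) hE.injective_map)).symm)
  exact flatDim_le_of_embedding hM.injective_module j hj

/-- Flat modules are Gorenstein flat. -/
theorem IsFlat.isGorensteinFlat {F : Type u} [AddCommGroup F] [Module R F] (hF : IsFlat R F) :
    IsGorensteinFlat R F := by
  -- The constant complex F × F with d(x, y) = (y, 0) is contracted by h(x, y) = (0, x). The
  -- identity dh + hd = 1 survives I ⊗ -, and the image of d is a copy of F.
  let d : F × F →ₗ[R] F × F := LinearMap.inl R F F ∘ₗ LinearMap.snd R F F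
  let h : F × F →ₗ[R] F × F := LinearMap.inr R F F ∘ₗ LinearMap.fst R F F
  have hdd : d ∘ₗ d = 0 := by ext <;> simp [d]
  have hdh : d ∘ₗ h + h ∘ₗ d = LinearMap.id := by ext <;> simp [d, h]
  have hex : Function.Exact d d := by
    intro x
    refine ⟨fun hx => ⟨h x, ?_⟩, fun ⟨y, hy⟩ => by rw [← hy]; exact LinearMap.congr_fun hdd y⟩
    have := LinearMap.congr_fun hdh x
    rwa [LinearMap.add_apply, LinearMap.comp_apply h d, hx, map_zero, add_zero] at this
  refine ⟨fun _ => ModuleCat.of R (F × F), fun _ => d, fun _ => hF.prod hF, fun _ => hex, ?_, ?_⟩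
  · intro I _ _ _ _ t
    constructor
    · intro ht
      refine ⟨tensMap LinearMap.id h t, ?_⟩
      have h1 : tensMap (LinearMap.id : I →ₗ[Rᵐᵒᵖ] I) (d ∘ₗ h + h ∘ₗ d) t = t := by
        rw [hdh, tensMap_id, LinearMap.id_apply]
      rw [tensMap_add_right, LinearMap.add_apply] at h1
      have h2 : tensMap (LinearMap.id : I →ₗ[Rᵐᵒᵖ] I) (h ∘ₗ d) t = 0 := by
        have := congrArg (tensMap (LinearMap.id : I →ₗ[Rᵐᵒᵖ] I) h) ht
        rwa [tensMap_tensMap, map_zero] at this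
      rw [h2, add_zero] at h1
      rw [tensMap_tensMap]
      exact h1
    · rintro ⟨y, rfl⟩
      rw [tensMap_tensMap]
      change tensMap _ (d ∘ₗ d) y = 0
      rw [hdd, tensMap_zero_right, LinearMap.zero_apply]
  · refine ⟨(LinearEquiv.ofInjective _ (LinearMap.inl_injective (R := R) (M := F) (M₂ := F))).trans
      (LinearEquiv.ofEq _ _ ?_)⟩
    exact (LinearMap.range_comp_of_range_eq_top _ (LinearMap.range_eq_top.2 Prod.snd_surjective)).symm

end Embedding

end InjEnvFlat

theorem theorem4p1 (R : Type u) [Ring R] [IsNoetherianRing R] [IsNoetherianRing Rᵐᵒᵖ] :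
    InjEnvFlat.flatDim R (InjEnvFlat.injEnvelope R R) =
        (⨆ (F : ModuleCat.{u} R) (_ : InjEnvFlat.IsFlat R F),
          InjEnvFlat.flatDim R (InjEnvFlat.injEnvelope R F)) ∧
    InjEnvFlat.flatDim R (InjEnvFlat.injEnvelope R R) =
        (⨆ (G : ModuleCat.{u} R) (_ : InjEnvFlat.IsGorensteinFlat R G),
          InjEnvFlat.flatDim R (InjEnvFlat.injEnvelope R G)) := by
  have hR := InjEnvFlat.isFlat_self R
  constructor
  · refine le_antisymm (le_iSup₂_of_le (ModuleCat.of R R) hR le_rfl) (iSup₂_le fun F hF => ?_)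
    exact InjEnvFlat.flatDim_injEnvelope_le hF LinearMap.id Function.injective_id
  · refine le_antisymm (le_iSup₂_of_le (ModuleCat.of R R) hR.isGorensteinFlat le_rfl)
      (iSup₂_le fun G hG => ?_)
    -- G is identified with the range of `d 0`, a submodule of the flat module `X (0 + 1)`.
    obtain ⟨X, d, hX, -, -, ⟨e⟩⟩ := hG
    exact InjEnvFlat.flatDim_injEnvelope_le (hX (0 + 1))
      ((LinearMap.range (d 0)).subtype ∘ₗ e.toLinearMap)
      (Subtype.val_injective.comp e.injective)
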